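/- A permutation $\pi\in S_n$ \emph{matches} $\sigma\in S_k$ if some (not necessarily contiguous) subsequence of the word $\pi[1]\cdots\pi[n]$ has the same relative order as $\sigma[1]\cdots\sigma[k]$; otherwise $\pi$ \emph{avoids} $\sigma$. Let $\mathrm{Av}_k(213,231)$ be the set of permutations in $S_k$ that avoid both $213$ and $231$. There is an algorithm (a single program for a unit-cost random access machine whose operations are copying, addition, truncated subtraction, comparison and indirect memory access, and which, on an input with parameters $k,n$, only ever holds words of $O(\log(k+n+2))$ bits) that, given arbitrary $\sigma\in \mathrm{Av}_k(213,231)$ and $\pi\in S_n$ (as the list $k,n,\sigma[1],\dots,\sigma[k],\pi[1],\dots,\pi[n]$ in memory), decides whether $\pi$ matches $\sigma$, and for $k,n\ge 1$ does so in $O(\max(kn^2,\ n^2\log\log n))$ time and $O(kn^2)$ space (memory cells), with absolute implied constants. Here $\log$ is the natural logarithm and the term $n^2\log\log n$ is omitted for $n\le 2$. -/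

import Mathlib

/-! ### Permutations and patterns

A permutation of length `n` is a bijection of `Fin n`; the letter `π[i+1]` of the one-line word of
`π` is `π i + 1`. -/

/-- `Matches π σ`: the permutation `π` matches the pattern `σ`, i.e. some subsequence of `π`
(taken at the positions `f 0 < f 1 < ⋯`) has the same relative order as `σ`. -/
def Matches {n k : ℕ} (π : Equiv.Perm (Fin n)) (σ : Equiv.Perm (Fin k)) : Prop :=
  ∃ f : Fin k → Fin n, StrictMono f ∧ ∀ i j : Fin k, σ i < σ j ↔ π (f i) < π (f j)

/-- `Av n P`: the permutations of length `n` that match no member of the set `P` of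
permutations (of arbitrary lengths). -/
def Av (n : ℕ) (P : Set (Σ m : ℕ, Equiv.Perm (Fin m))) : Set (Equiv.Perm (Fin n)) :=
  {π | ∀ τ ∈ P, ¬ Matches π τ.2}

/-- The permutation `213` (zero-based one-line word `1, 0, 2`). -/
def perm213 : Equiv.Perm (Fin 3) where
  toFun := ![1, 0, 2]
  invFun := ![1, 0, 2]
  left_inv := by decide
  right_inv := by decide

/-- The permutation `231` (zero-based one-line word `1, 2, 0`). -/
def perm231 : Equiv.Perm (Fin 3) where
  toFun := ![1, 2, 0]
  invFun := ![2, 0, 1]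
  left_inv := by decide
  right_inv := by decide

/-! ### Random access machines

The unit-cost random access machine with addition, truncated subtraction, comparison and indirect
addressing. A program is a fixed finite list of instructions; it mentions finitely many registers,
and has an unlimited memory of cells with addresses `0, 1, 2, …`. -/

namespace RAM

/-- Instructions. Registers and jump targets are given by their index; `mem[·]` is the memory. -/
inductive Instr : Type
  /-- `r i := c`, for a constant `c` -/
  | const (i c : ℕ)
  /-- `r i := r j` -/
  | copy (i j : ℕ)
  /-- `r i := r j + r l` -/
  | add (i j l : ℕ)
  /-- `r i := r j - r l`, truncated at `0` -/
  | sub (i j l : ℕ)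
  /-- `r i := mem[r j]` -/
  | load (i j : ℕ)
  /-- `mem[r i] := r j` -/
  | store (i j : ℕ)
  /-- continue at instruction number `target` -/
  | jump (target : ℕ)
  /-- if `r i < r j` then continue at instruction number `target` -/
  | jumpLt (i j target : ℕ)
  /-- stop with the answer yes (`true`) or no (`false`) -/
  | halt (answer : Bool)

/-- A program: instruction number `p` is the entry of index `p` of the list. -/
abbrev Program : Type := List Instr

/-- A configuration: the number of the next instruction, the registers and the memory. -/
structure Config : Type where
  pc : ℕ
  reg : ℕ → ℕ
  mem : ℕ → ℕ

/-- The effect of one instruction; `halt` leaves the configuration unchanged. -/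
def Instr.exec (c : Config) : Instr → Config
  | .const i v => { c with pc := c.pc + 1, reg := Function.update c.reg i v }
  | .copy i j => { c with pc := c.pc + 1, reg := Function.update c.reg i (c.reg j) }
  | .add i j l => { c with pc := c.pc + 1, reg := Function.update c.reg i (c.reg j + c.reg l) }
  | .sub i j l => { c with pc := c.pc + 1, reg := Function.update c.reg i (c.reg j - c.reg l) }
  | .load i j => { c with pc := c.pc + 1, reg := Function.update c.reg i (c.mem (c.reg j)) }
  | .store i j => { c with pc := c.pc + 1, mem := Function.update c.mem (c.reg i) (c.reg j) }
  | .jump target => { c with pc := target }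
  | .jumpLt i j target => { c with pc := if c.reg i < c.reg j then target else c.pc + 1 }
  | .halt _ => c

/-- The memory address that an instruction reads or writes, if any. -/
def Instr.address (c : Config) : Instr → Option ℕ
  | .load _ j => some (c.reg j)
  | .store i _ => some (c.reg i)
  | _ => none

/-- The initial configuration on an input `x`, a list of natural numbers: the first memory cells
hold `x`, all other cells and all registers hold `0`. -/
def initial (x : List ℕ) : Config where
  pc := 0
  reg := fun _ => 0
  mem := fun a => x.getD a 0

namespace Program

/-- One step: execute the current instruction. If there is none, the machine is stuck forever
(and does not count as having halted). -/
def step (P : Program) (c : Config) : Config :=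
  match P[c.pc]? with
  | some I => I.exec c
  | none => c

/-- The configuration after `t` steps on the input `x`. -/
def run (P : Program) (x : List ℕ) (t : ℕ) : Config :=
  P.step^[t] (initial x)

/-- On the input `x`, the program `P` has halted after at most `t` steps with the given answer. -/
def HaltsWithin (P : Program) (x : List ℕ) (t : ℕ) (answer : Bool) : Prop :=
  P[(P.run x t).pc]? = some (Instr.halt answer)

/-- On the input `x`, the program `P` uses at most the first `s` memory cells: every address that it
ever reads or writes is less than `s`. -/
def SpaceWithin (P : Program) (x : List ℕ) (s : ℕ) : Prop :=
  ∀ (t : ℕ) (I : Instr) (a : ℕ), P[(P.run x t).pc]? = some I →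
    I.address (P.run x t) = some a → a < s

/-- On the input `x`, no register and no memory cell ever holds a number greater than `w`. -/
def WordsWithin (P : Program) (x : List ℕ) (w : ℕ) : Prop :=
  ∀ t i : ℕ, (P.run x t).reg i ≤ w ∧ (P.run x t).mem i ≤ w

end Program

end RAM

/-- The input list `k, n, σ[1], …, σ[k], π[1], …, π[n]` with the letters in `{1, …, k}` and
`{1, …, n}`, respectively. -/
def matchingInput {k n : ℕ} (σ : Equiv.Perm (Fin k)) (π : Equiv.Perm (Fin n)) : List ℕ :=
  k :: n :: (List.ofFn (fun i : Fin k => (σ i : ℕ) + 1) ++ List.ofFn (fun j : Fin n => (π j : ℕ) + 1))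

/-!
In a pattern that avoids `213` and `231` every letter is the least or the greatest of the letters
from it on, and comparing it with the next letter tells which (`lt_iff_lt_of_mem_Av`). Hence, when
the pattern is placed on the text from its end to its beginning, a placement of a suffix is extended
by one letter as soon as that letter lies below, or above, all letters used so far: of the letters
used only their range matters. For a suffix starting at `i`, the last `q` letters of the text and an
upper bound `h` on the letters used, it suffices to know the best, i.e. the largest possible, lower
bound. These numbers form the table `table k n s v q i h`, each of whose entries is found in constant
time from entries for `q - 1`; `le_table_iff` says that the recursion is right, and
`matches_iff_table_pos` that the entry for the whole pattern and the whole text decides the matching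
problem.

There are `(k + 1) (n + 2)` pairs `(i, h)` and `n` values of `q`, so that the table is computed in
`O(k n ^ 2)` time; as it is updated in place, it takes `O(k n)` memory cells. The `log log` term of
the bound is not needed. The program `RAM.matcher` does this computation. It is verified with
the relation `RAM.Reaches`, which records the number of steps together with the bounds on addresses
and words, by one invariant for each of its loops; the outcome is `RAM.matcher_reaches_halt`.
-/

/-! ### The dynamic program -/

/-- The recursion at the heart of the algorithm. Here `s` is the word of the pattern (of length
`k`) and `v` the word of the text (of length `n`), both indexed from `0`. `table k n s v q i h` is
the largest `l ≥ 1` such that the suffix of the pattern that starts at `i` occurs among the last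
`q` letters of the text with all its letters in `[l, h)`, and `0` if there is none; for the empty
suffix (`i = k`) it is `h`. -/
def table (k n : ℕ) (s v : ℕ → ℕ) : ℕ → ℕ → ℕ → ℕ
  | 0, i, h => if i < k then 0 else h
  | q + 1, i, h =>
    if i < k then
      max (table k n s v q i h)
        (if s i < s (i + 1) then
          if v (n - 1 - q) < table k n s v q (i + 1) h then v (n - 1 - q) else 0
        else
          if v (n - 1 - q) < h then table k n s v q (i + 1) (v (n - 1 - q)) else 0)
    else h

theorem table_of_le {k n : ℕ} {s v : ℕ → ℕ} (q : ℕ) {i : ℕ} (h : ℕ) (hi : k ≤ i) :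
    table k n s v q i h = h := by
  cases q <;> simp [table, hi]

theorem table_le (k n : ℕ) (s v : ℕ → ℕ) (q i h : ℕ) : table k n s v q i h ≤ h := by
  induction q generalizing i h with
  | zero => simp only [table]; split <;> omega
  | succ q ih =>
    have h1 := ih i h
    have h2 := ih (i + 1) h
    have h3 := ih (i + 1) (v (n - 1 - q))
    simp only [table]
    split_ifs <;> omega

/-- `Fits k n s v q i l h`: the suffix of the pattern that starts at `i` can be placed on the last
`q` positions of the text, with letters in `[l, h)`, so that each letter compares with all later
ones as `s a` compares with `s (a + 1)`. -/
def Fits (k n : ℕ) (s v : ℕ → ℕ) (q i l h : ℕ) : Prop :=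
  ∃ f : ℕ → ℕ,
    (∀ a, i ≤ a → a < k → n - q ≤ f a ∧ f a < n ∧ l ≤ v (f a) ∧ v (f a) < h) ∧
    ∀ a b, i ≤ a → a < b → b < k → f a < f b ∧ (s a < s (a + 1) ↔ v (f a) < v (f b))

section Fits

variable {k n : ℕ} {s v : ℕ → ℕ} {q i l h : ℕ}

theorem fits_of_le (hi : k ≤ i) : Fits k n s v q i l h :=
  ⟨id, fun a _ _ => by omega, fun a b _ _ _ => by omega⟩

theorem not_fits_zero (hi : i < k) : ¬ Fits k n s v 0 i l h := by
  rintro ⟨f, hf, -⟩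
  have := hf i le_rfl hi
  omega

theorem Fits.succ (H : Fits k n s v q i l h) : Fits k n s v (q + 1) i l h := by
  obtain ⟨f, hf, hf'⟩ := H
  refine ⟨f, fun a ha hk => ?_, hf'⟩
  have := hf a ha hk
  omega

/-- A placement of the suffix from `i + 1` on is extended by placing `i` on the position before
it. -/
theorem Fits.cons {l' h' : ℕ} (hq : q < n) (H : Fits k n s v q (i + 1) l' h')
    (hl : l ≤ l') (hh : h' ≤ h) (hl' : l ≤ v (n - 1 - q)) (hh' : v (n - 1 - q) < h)
    (hlt : s i < s (i + 1) → v (n - 1 - q) < l')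
    (hge : ¬ s i < s (i + 1) → h' ≤ v (n - 1 - q)) :
    Fits k n s v (q + 1) i l h := by
  obtain ⟨f, hf, hf'⟩ := H
  refine ⟨fun a => if a = i then n - 1 - q else f a, fun a ha hk => ?_, fun a b ha hab hb => ?_⟩
  · by_cases h1 : a = i
    · simp only [h1, if_true]; omega
    · have := hf a (by omega) hk
      simp only [h1, if_false]; omega
  · have h2 : b ≠ i := by omega
    have h3 := hf b (by omega) hb
    by_cases h1 : a = i
    · subst h1
      simp only [h2, if_true, if_false]
      refine ⟨by omega, fun h4 => ?_, fun h4 => ?_⟩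
      · have := hlt h4; omega
      · by_contra h5
        have := hge h5; omega
    · simp only [h1, h2, if_false]
      exact hf' a b (by omega) hab hb

/-- Either the first of the last `q + 1` positions of the text is not used, or it carries the
first letter of the suffix, which is then the least or the greatest letter used. -/
theorem fits_succ_iff (hv : Set.InjOn v (Set.Iio n)) (hq : q < n) (hi : i < k) :
    Fits k n s v (q + 1) i l h ↔ Fits k n s v q i l h ∨
      (l ≤ v (n - 1 - q) ∧ v (n - 1 - q) < h ∧
        if s i < s (i + 1) then Fits k n s v q (i + 1) (v (n - 1 - q) + 1) h
        else Fits k n s v q (i + 1) l (v (n - 1 - q))) := by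
  constructor
  · rintro ⟨f, hf, hf'⟩
    have h0 := hf i le_rfl hi
    have hmono : ∀ a, i < a → a < k → f i < f a := fun a ha hk => (hf' i a le_rfl ha hk).1
    by_cases hp : f i = n - 1 - q
    · right
      rw [← hp]
      refine ⟨h0.2.2.1, h0.2.2.2, ?_⟩
      split_ifs with hs
      · refine ⟨f, fun a ha hk => ?_, fun a b ha => hf' a b (by omega)⟩
        have h1 := hf a (by omega) hk
        have h2 := hf' i a le_rfl (by omega) hk
        have h3 := h2.2.1 hs
        omega
      · refine ⟨f, fun a ha hk => ?_, fun a b ha => hf' a b (by omega)⟩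
        have h1 := hf a (by omega) hk
        have h2 := hf' i a le_rfl (by omega) hk
        have h3 : ¬ v (f i) < v (f a) := fun h => hs (h2.2.2 h)
        have h4 : v (f i) ≠ v (f a) := fun h => by
          have := hv (Set.mem_Iio.2 h0.2.1) (Set.mem_Iio.2 h1.2.1) h
          omega
        omega
    · left
      refine ⟨f, fun a ha hk => ?_, hf'⟩
      have h1 := hf a ha hk
      have h2 : f i ≤ f a := by
        rcases ha.eq_or_lt with rfl | ha
        · exact le_rfl
        · exact (hmono a ha hk).le
      omega
  · rintro (H | ⟨h1, h2, H⟩)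
    · exact H.succ
    · split_ifs at H with hs
      · exact H.cons hq (by omega) le_rfl h1 h2 (fun _ => by omega) (fun h => absurd hs h)
      · exact H.cons hq le_rfl h2.le h1 h2 (fun h => absurd h hs) (fun _ => le_rfl)

/-- The recursion computes what it is meant to compute. -/
theorem le_table_iff (hv : Set.InjOn v (Set.Iio n)) (hq : q ≤ n) (hl : 1 ≤ l) :
    l ≤ table k n s v q i h ↔ l ≤ h ∧ Fits k n s v q i l h := by
  induction q generalizing i l h with
  | zero =>
    by_cases hi : i < k
    · simp only [table, hi, if_true, not_fits_zero hi, and_false, iff_false]; omega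
    · simp [table, hi, fits_of_le (not_lt.1 hi)]
  | succ q ih =>
    by_cases hi : i < k
    · have h1 := @ih i l h (by omega) hl
      have h2 := @ih (i + 1) (v (n - 1 - q) + 1) h (by omega) (by omega)
      have h3 := @ih (i + 1) l (v (n - 1 - q)) (by omega) hl
      rw [fits_succ_iff hv hq hi]
      simp only [table, hi, if_true, le_max_iff, h1]
      by_cases hs : s i < s (i + 1)
      · simp only [hs, if_true]
        rw [Nat.add_one_le_iff, Nat.add_one_le_iff] at h2
        split_ifs with h4
        · have := h2.1 h4
          constructor
          · rintro (h5 | h5)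
            · exact ⟨h5.1, Or.inl h5.2⟩
            · exact ⟨by omega, Or.inr ⟨h5, this⟩⟩
          · rintro ⟨h5, h6 | h6⟩
            · exact Or.inl ⟨h5, h6⟩
            · exact Or.inr h6.1
        · constructor
          · rintro (h5 | h5)
            · exact ⟨h5.1, Or.inl h5.2⟩
            · omega
          · rintro ⟨h5, h6 | h6⟩
            · exact Or.inl ⟨h5, h6⟩
            · exact absurd (h2.2 h6.2) h4
      · simp only [hs, if_false]
        split_ifs with h4
        · rw [h3]
          constructor
          · rintro (h5 | h5)
            · exact ⟨h5.1, Or.inl h5.2⟩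
            · exact ⟨by omega, Or.inr ⟨h5.1, h4, h5.2⟩⟩
          · rintro ⟨h5, h6 | h6⟩
            · exact Or.inl ⟨h5, h6⟩
            · exact Or.inr ⟨h6.1, h6.2.2⟩
        · constructor
          · rintro (h5 | h5)
            · exact ⟨h5.1, Or.inl h5.2⟩
            · omega
          · rintro ⟨h5, h6 | h6⟩
            · exact Or.inl ⟨h5, h6⟩
            · exact absurd h6.2.1 h4
    · rw [table_of_le _ _ (not_lt.1 hi)]
      simp [fits_of_le (not_lt.1 hi)]

end Fits

/-! ### Wedge patterns -/

/-- In a permutation that avoids `213` and `231`, every letter is the least or the greatest of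
those from it on: all later letters lie on the same side of it. -/
theorem lt_iff_lt_of_mem_Av {k : ℕ} {σ : Equiv.Perm (Fin k)}
    (hσ : σ ∈ Av k {⟨3, perm213⟩, ⟨3, perm231⟩}) {a b c : Fin k} (hab : a < b) (hac : a < c) :
    σ a < σ b ↔ σ a < σ c := by
  have key : ∀ b c : Fin k, a < b → b < c → (σ a < σ b ↔ σ a < σ c) := by
    intro b c hab hbc
    have hmono : StrictMono ![a, b, c] := by
      intro i j hij
      fin_cases i <;> fin_cases j <;> simp_all
      exact hab.trans hbc
    have nab : σ a ≠ σ b := fun h => hab.ne (σ.injective h)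
    have nac : σ a ≠ σ c := fun h => (hab.trans hbc).ne (σ.injective h)
    have h213 := hσ ⟨3, perm213⟩ (by simp)
    have h231 := hσ ⟨3, perm231⟩ (by simp)
    constructor
    · intro h
      by_contra h'
      refine h231 ⟨_, hmono, fun i j => ?_⟩
      have : σ c < σ a := lt_of_le_of_ne (not_lt.1 h') nac.symm
      have := this.trans h
      fin_cases i <;> fin_cases j <;> simp [perm231] <;> order
    · intro h
      by_contra h'
      refine h213 ⟨_, hmono, fun i j => ?_⟩
      have : σ b < σ a := lt_of_le_of_ne (not_lt.1 h') nab.symm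
      have := this.trans h
      fin_cases i <;> fin_cases j <;> simp [perm213] <;> order
  rcases lt_trichotomy b c with h | h | h
  · exact key b c hab h
  · rw [h]
  · exact (key c b hac h).symm

/-- For a wedge pattern, matching is the fitting of the whole pattern into the whole text. -/
theorem matches_iff_fits {k n : ℕ} {σ : Equiv.Perm (Fin k)} {π : Equiv.Perm (Fin n)}
    (hσ : σ ∈ Av k {⟨3, perm213⟩, ⟨3, perm231⟩}) {s v : ℕ → ℕ}
    (hs : ∀ i : Fin k, s i = σ i + 1) (hv : ∀ j : Fin n, v j = π j + 1) :
    Matches π σ ↔ Fits k n s v n 0 1 (n + 1) := by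
  have hs' : ∀ a b (ha : a < k) (hb : b < k), a < b →
      (s a < s (a + 1) ↔ σ ⟨a, ha⟩ < σ ⟨b, hb⟩) := by
    intro a b ha hb hab
    have h1 := hs ⟨a, ha⟩
    have h2 := hs ⟨a + 1, by omega⟩
    rw [lt_iff_lt_of_mem_Av hσ (b := ⟨b, hb⟩) (c := ⟨a + 1, by omega⟩) (by simpa using hab)
      (by simp), Fin.lt_def]
    simp only at h1 h2
    omega
  have hv' : ∀ a b : Fin n, v a < v b ↔ π a < π b := by
    intro a b
    rw [hv, hv, Fin.lt_def]; omega
  constructor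
  · rintro ⟨f, hf, hf'⟩
    refine ⟨fun a => if h : a < k then f ⟨a, h⟩ else 0, fun a _ ha => ?_, fun a b _ hab hb => ?_⟩
    · have h1 := hv (f ⟨a, ha⟩)
      have h2 := (π (f ⟨a, ha⟩)).isLt
      simp only [ha, dif_pos]
      omega
    · have ha : a < k := by omega
      simp only [ha, hb, dif_pos]
      refine ⟨hf (by simpa using hab), ?_⟩
      rw [hs' a b ha hb hab, hv', hf']
  · rintro ⟨f, hf, hf'⟩
    have hlt : ∀ i j : Fin k, i < j →
        (σ i < σ j ↔ π ⟨f i, (hf i (by omega) i.2).2.1⟩ < π ⟨f j, (hf j (by omega) j.2).2.1⟩) := by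
      intro i j hij
      rw [← hv', ← hs' i j i.2 j.2 hij]
      exact (hf' i j (by omega) hij j.2).2
    have hmono : ∀ i j : Fin k, i < j → f i < f j := fun i j hij => (hf' i j (by omega) hij j.2).1
    refine ⟨fun i => ⟨f i, (hf i (by omega) i.2).2.1⟩, fun i j hij => hmono i j hij,
      fun i j => ?_⟩
    rcases lt_trichotomy i j with h | h | h
    · exact hlt i j h
    · subst h; simp
    · have h1 : σ j ≠ σ i := fun e => h.ne (σ.injective e)
      have h2 : π ⟨f j, (hf j (by omega) j.2).2.1⟩ ≠ π ⟨f i, (hf i (by omega) i.2).2.1⟩ :=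
        fun e => (hmono j i h).ne (by simpa using π.injective e)
      rw [← not_iff_not, not_lt, not_lt, le_iff_lt_or_eq, le_iff_lt_or_eq, or_iff_left h1,
        or_iff_left h2]
      exact hlt j i h

theorem matches_iff_table_pos {k n : ℕ} {σ : Equiv.Perm (Fin k)} {π : Equiv.Perm (Fin n)}
    (hσ : σ ∈ Av k {⟨3, perm213⟩, ⟨3, perm231⟩}) {s v : ℕ → ℕ}
    (hs : ∀ i : Fin k, s i = σ i + 1) (hv : ∀ j : Fin n, v j = π j + 1) :
    Matches π σ ↔ 0 < table k n s v n 0 (n + 1) := by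
  have hinj : Set.InjOn v (Set.Iio n) := by
    intro a ha b hb hab
    have h1 := hv ⟨a, ha⟩
    have h2 := hv ⟨b, hb⟩
    simp only at h1 h2
    have h3 : π ⟨a, ha⟩ = π ⟨b, hb⟩ := Fin.ext (by omega)
    exact congrArg Fin.val (π.injective h3)
  rw [matches_iff_fits hσ hs hv, ← Nat.succ_le_iff, Nat.succ_eq_add_one, zero_add,
    le_table_iff hinj le_rfl le_rfl]
  simp

/-! ### Reasoning about runs of a random access machine -/

namespace RAM

/-- The conditions under which executing an instruction respects the word bound `w` and the space
bound `s`. Only `const` and `add` can create a number larger than those already present. -/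
def Instr.Ok (w s : ℕ) (c : Config) : Instr → Prop
  | .const _ v => v ≤ w
  | .add _ j l => c.reg j + c.reg l ≤ w
  | .load _ j => c.reg j < s
  | .store i _ => c.reg i < s
  | _ => True

/-- `Reaches P w s Q N c`: from the configuration `c` the program `P` arrives within `N` steps at a
configuration that satisfies `Q`, and each instruction executed on the way respects the word
bound `w` and the space bound `s`. -/
inductive Reaches (P : Program) (w s : ℕ) (Q : Config → Prop) : ℕ → Config → Prop
  | done {N : ℕ} {c : Config} : Q c → Reaches P w s Q N c
  | step {N : ℕ} {c : Config} {I : Instr} : P[c.pc]? = some I → I.Ok w s c →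
      Reaches P w s Q N (I.exec c) → Reaches P w s Q (N + 1) c

namespace Reaches

variable {P : Program} {w s : ℕ} {Q R : Config → Prop} {N M : ℕ} {c : Config}

theorem mono (H : Reaches P w s Q N c) (h : N ≤ M) : Reaches P w s Q M c := by
  induction H generalizing M with
  | done hQ => exact .done hQ
  | step hP hI _ ih =>
    obtain ⟨M, rfl⟩ : ∃ M', M = M' + 1 := ⟨M - 1, by omega⟩
    exact .step hP hI (ih (by omega))

theorem trans (H : Reaches P w s Q N c) (h : ∀ c, Q c → Reaches P w s R M c) :
    Reaches P w s R (N + M) c := by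
  induction H with
  | done hQ => exact (h _ hQ).mono (by omega)
  | step hP hI _ ih =>
    rw [Nat.add_right_comm]
    exact .step hP hI ih

theorem jumpLt_pos {i j t : ℕ} (hP : P[c.pc]? = some (.jumpLt i j t)) (h : c.reg i < c.reg j)
    (H : Reaches P w s Q N ⟨t, c.reg, c.mem⟩) : Reaches P w s Q (N + 1) c :=
  .step hP trivial (by simpa [Instr.exec, h] using H)

theorem jumpLt_neg {i j t : ℕ} (hP : P[c.pc]? = some (.jumpLt i j t)) (h : ¬ c.reg i < c.reg j)
    (H : Reaches P w s Q N ⟨c.pc + 1, c.reg, c.mem⟩) : Reaches P w s Q (N + 1) c :=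
  .step hP trivial (by simpa [Instr.exec, h] using H)

/-- A loop that runs `m` times, with invariant `J` and at most `b` steps in each round. -/
theorem loop (J : ℕ → Config → Prop) (m b : ℕ)
    (hJ : ∀ j < m, ∀ c, J j c → Reaches P w s (J (j + 1)) b c) (h0 : J 0 c) :
    Reaches P w s (J m) (m * b) c := by
  induction m with
  | zero => exact .done h0
  | succ m ih =>
    rw [Nat.succ_mul]
    exact (ih fun j hj => hJ j (by omega)).trans (hJ m (by omega))

end Reaches

/-- An instruction whose conditions are met keeps all words within the bound. -/
theorem Instr.exec_le {w s : ℕ} {c : Config} (hc : ∀ i, c.reg i ≤ w ∧ c.mem i ≤ w) {I : Instr}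
    (hI : I.Ok w s c) (i : ℕ) : (I.exec c).reg i ≤ w ∧ (I.exec c).mem i ≤ w := by
  have hr := fun j => (hc j).1
  have hm := fun j => (hc j).2
  cases I <;> simp only [Instr.exec, Instr.Ok, Function.update_apply] at hI ⊢ <;>
    refine ⟨?_, ?_⟩ <;> try split_ifs
  all_goals first
    | exact hr _
    | exact hm _
    | exact hI
    | exact (Nat.sub_le _ _).trans (hr _)

theorem Program.step_eq {P : Program} {c : Config} {I : Instr} (h : P[c.pc]? = some I) :
    P.step c = I.exec c := by
  simp [Program.step, h]

/-- A halting configuration is a fixed point, so that the bounds along the run up to it are bounds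
for the whole infinite run. -/
theorem Reaches.spec {P : Program} {w s N : ℕ} {c : Config} {answer : Bool}
    (H : Reaches P w s (fun c => P[c.pc]? = some (.halt answer)) N c)
    (hc : ∀ i, c.reg i ≤ w ∧ c.mem i ≤ w) :
    P[(P.step^[N] c).pc]? = some (.halt answer) ∧
      (∀ t i, (P.step^[t] c).reg i ≤ w ∧ (P.step^[t] c).mem i ≤ w) ∧
      ∀ (t : ℕ) (I : Instr) (a : ℕ), P[(P.step^[t] c).pc]? = some I →
        I.address (P.step^[t] c) = some a → a < s := by
  induction H with
  | @done N c hQ =>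
    have hfix : ∀ t, P.step^[t] c = c := fun t =>
      Function.iterate_fixed (by rw [Program.step_eq hQ]; rfl) t
    simp only [hfix]
    refine ⟨hQ, fun _ => hc, fun _ I a hI ha => ?_⟩
    obtain rfl : Instr.halt answer = I := by rw [hQ] at hI; exact Option.some.inj hI
    simp [Instr.address] at ha
  | @step N c I hP hI _ ih =>
    obtain ⟨h1, h2, h3⟩ := ih (Instr.exec_le hc hI)
    have hs : ∀ t, P.step^[t + 1] c = P.step^[t] (I.exec c) := fun t => by
      rw [Function.iterate_succ_apply, Program.step_eq hP]
    refine ⟨by rw [hs]; exact h1, fun t => ?_, fun t J a hJ ha => ?_⟩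
    · cases t with
      | zero => exact hc
      | succ t => rw [hs]; exact h2 t
    · cases t with
      | zero =>
        obtain rfl : I = J := by
          simp only [Function.iterate_zero, id] at hJ
          rw [hP] at hJ; exact Option.some.inj hJ
        cases I <;> simp [Instr.address, Instr.Ok] at ha hI <;> omega
      | succ t => rw [hs] at hJ ha; exact h3 t J a hJ ha

/-! ### The program and its invariants -/

/-- The program. The table is kept, row after row, in the cells from `k + n + 2` on, each row having
`n + 2` cells; it is updated in place for one letter of the text after the other, from the last to
the first. Cells after the input hold `0`, so that only row `k` needs to be initialized. -/
def matcher : Program := [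
  -- registers `1` to `6`: the constants `1`, `k`, `n`, `n + 1`, `n + 2`, `k + n + 2`
  .const 1 1, .load 2 0, .load 3 1, .add 4 3 1, .add 5 4 1, .add 6 2 5,
  -- instructions 6 to 11: register `7` receives the address of row `k`
  .copy 7 6, .jumpLt 8 2 9, .jump 12, .add 7 7 5, .add 8 8 1, .jump 7,
  -- instructions 12 to 17: entry `h` of row `k` becomes `h`
  .jumpLt 9 5 14, .jump 18, .store 7 9, .add 7 7 1, .add 9 9 1, .jump 12,
  -- instructions 18 to 27: register `11` runs down through the text, register `13` is the letter
  .copy 11 6, .add 12 2 1, .add 12 12 1, .jumpLt 12 11 23, .jump 56,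
  .sub 11 11 1, .load 13 11, .const 8 0, .copy 7 6, .const 14 2,
  -- instructions 28 to 36: register `8` is the row `i`; registers `15` and `16` are two consecutive
  -- letters of the pattern; register `17` points into row `i + 1`; register `18` is the entry
  -- of that row at the letter of the text
  .jumpLt 8 2 30, .jump 21,
  .load 15 14, .add 14 14 1, .load 16 14, .const 9 0, .add 17 7 5, .add 18 17 13, .load 18 18,
  -- instructions 37 to 55: register `9` is the column `h`, register `7` points to the entry, which
  -- is replaced by the maximum of itself and, if applicable, register `21`
  .jumpLt 9 5 40, .add 8 8 1, .jump 28,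
  .load 19 17, .load 20 7, .jumpLt 15 16 46, .copy 19 9, .copy 21 18, .jump 47, .copy 21 13,
  .jumpLt 13 19 49, .jump 51, .sub 21 21 20, .add 20 20 21, .store 7 20,
  .add 7 7 1, .add 17 17 1, .add 9 9 1, .jump 37,
  -- instructions 56 to 60: the answer is read off the last entry of row `0`
  .add 22 6 4, .load 22 22, .jumpLt 0 22 60, .halt false, .halt true]

/-- What holds from the end of the initialization of the registers on: the constants are in
registers `0` to `6`, and the input part of the memory is that of `m`. -/
structure Frame (k n : ℕ) (m : ℕ → ℕ) (c : Config) : Prop where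
  r0 : c.reg 0 = 0
  r1 : c.reg 1 = 1
  r2 : c.reg 2 = k
  r3 : c.reg 3 = n
  r4 : c.reg 4 = n + 1
  r5 : c.reg 5 = n + 2
  r6 : c.reg 6 = k + n + 2
  input : ∀ a < k + n + 2, c.mem a = m a

/-- Entry `h` of row `i` of the table. -/
def cell (k n i h : ℕ) : ℕ := k + n + 2 + i * (n + 2) + h

theorem cell_inj {k n i h i' h' : ℕ} (hh : h < n + 2) (hh' : h' < n + 2) :
    cell k n i h = cell k n i' h' ↔ i = i' ∧ h = h' := by
  refine ⟨fun e => ?_, fun e => by rw [e.1, e.2]⟩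
  unfold cell at e
  have e' : h + (n + 2) * i = h' + (n + 2) * i' := by linarith
  have h1 : i = i' := by
    have := congrArg (· / (n + 2)) e'
    simpa [Nat.add_mul_div_left, Nat.div_eq_of_lt hh, Nat.div_eq_of_lt hh'] using this
  subst h1
  exact ⟨rfl, by omega⟩

theorem cell_lt {k n i h : ℕ} (hi : i ≤ k) (hh : h < n + 2) :
    cell k n i h < k + n + 2 + (k + 1) * (n + 2) := by
  have := Nat.mul_le_mul_right (n + 2) hi
  have h1 : (k + 1) * (n + 2) = k * (n + 2) + (n + 2) := by ring
  unfold cell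
  omega

theorem cell_row_succ (k n i h : ℕ) : cell k n (i + 1) h = cell k n i h + (n + 2) := by
  unfold cell; ring

theorem cell_add (k n i h j : ℕ) : cell k n i (h + j) = cell k n i h + j := by
  unfold cell; ring

theorem le_cell (k n i h : ℕ) : k + n + 2 ≤ cell k n i h := by
  unfold cell; omega

theorem cell_zero_zero (k n : ℕ) : cell k n 0 0 = k + n + 2 := by
  unfold cell; ring

/-- The table for the input stored in `m`: the pattern starts at address `2`, the text at
address `k + 2`. -/
def memTable (k n : ℕ) (m : ℕ → ℕ) : ℕ → ℕ → ℕ → ℕ :=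
  table k n (fun i => m (2 + i)) (fun j => m (2 + k + j))

/-- The state of the table in memory while the letter number `q` from the end is processed: entries
before entry `h` of row `i` are up to date, the others still ignore that letter. -/
def TableAt (k n : ℕ) (m : ℕ → ℕ) (q i h : ℕ) (c : Config) : Prop :=
  ∀ i' ≤ k, ∀ h' < n + 2, c.mem (cell k n i' h') =
    if i' < i ∨ i' = i ∧ h' < h then memTable k n m (q + 1) i' h' else memTable k n m q i' h'

/-- The invariant of the loop over the letters of the text, after `q` letters. -/
structure TextInv (k n : ℕ) (m : ℕ → ℕ) (q : ℕ) (c : Config) : Prop extends Frame k n m c where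
  pc : c.pc = 21
  r11 : c.reg 11 = k + n + 2 - q
  r12 : c.reg 12 = k + 2
  tab : TableAt k n m q 0 0 c

/-- The invariant of the loop over the rows, after `i` rows. -/
structure RowInv (k n : ℕ) (m : ℕ → ℕ) (q i : ℕ) (c : Config) : Prop extends Frame k n m c where
  pc : c.pc = 28
  r11 : c.reg 11 = k + n + 1 - q
  r12 : c.reg 12 = k + 2
  r13 : c.reg 13 = m (2 + k + (n - 1 - q))
  r8 : c.reg 8 = i
  r7 : c.reg 7 = cell k n i 0
  r14 : c.reg 14 = 2 + i
  tab : TableAt k n m q i 0 c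

/-- The invariant of the loop over the entries of a row, after `h` entries. -/
structure EntryInv (k n : ℕ) (m : ℕ → ℕ) (q i h : ℕ) (c : Config) : Prop
    extends Frame k n m c where
  pc : c.pc = 37
  r11 : c.reg 11 = k + n + 1 - q
  r12 : c.reg 12 = k + 2
  r13 : c.reg 13 = m (2 + k + (n - 1 - q))
  r8 : c.reg 8 = i
  r7 : c.reg 7 = cell k n i h
  r14 : c.reg 14 = 2 + i + 1
  r15 : c.reg 15 = m (2 + i)
  r16 : c.reg 16 = m (2 + i + 1)
  r9 : c.reg 9 = h
  r17 : c.reg 17 = cell k n (i + 1) h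
  r18 : c.reg 18 = memTable k n m q (i + 1) (m (2 + k + (n - 1 - q)))
  tab : TableAt k n m q i h c

/-! ### Verification of the program -/

section Verification

variable {k n w : ℕ} {m : ℕ → ℕ}

local notation "Run" => Reaches matcher w (k + n + 2 + (k + 1) * (n + 2))

theorem memTable_le (q i h : ℕ) : memTable k n m q i h ≤ h := table_le ..

theorem memTable_last (q h : ℕ) : memTable k n m q k h = h := table_of_le _ _ le_rfl

theorem TableAt.store {q i h x : ℕ} {c c' : Config} (H : TableAt k n m q i h c)
    (hh : h < n + 2) (hc : c'.mem = Function.update c.mem (cell k n i h) x)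
    (hx : x = memTable k n m (q + 1) i h) : TableAt k n m q i (h + 1) c' := by
  intro i' hi' h' hh'
  rw [hc, Function.update_apply]
  simp only [cell_inj hh' hh]
  split_ifs with h1 h2 h2
  · rw [hx, h1.1, h1.2]
  · omega
  · rw [H i' hi' h' hh', if_pos (by omega)]
  · rw [H i' hi' h' hh', if_neg (by omega)]

/-- Processing one entry of the table. -/
theorem EntryInv.next {q i h : ℕ} {c : Config} (H : EntryInv k n m q i h c)
    (hw : k + n + 2 + (k + 1) * (n + 2) ≤ w) (hi : i < k) (hh : h < n + 2) :
    Run (EntryInv k n m q i (h + 1)) 20 c := by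
  obtain ⟨pc, r, μ⟩ := c
  obtain ⟨⟨r0, r1, r2, r3, r4, r5, r6, input⟩, hpc, r11, r12, r13, r8, r7, r14, r15, r16, r9, r17,
    r18, tab⟩ := H
  simp only at *
  subst hpc
  have a1 := cell_lt hi.le hh
  have a2 := cell_lt (i := i + 1) hi hh
  have a4 := le_cell k n i h
  have old := tab i hi.le h hh
  have nxt := tab (i + 1) hi h hh
  rw [if_neg (by omega)] at old nxt
  simp only at old nxt
  have b2 := memTable_le (k := k) (n := n) (m := m) (q + 1) i h
  have new : memTable k n m (q + 1) i h = max (memTable k n m q i h)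
      (if m (2 + i) < m (2 + i + 1) then
        if m (2 + k + (n - 1 - q)) < memTable k n m q (i + 1) h then m (2 + k + (n - 1 - q)) else 0
      else if m (2 + k + (n - 1 - q)) < h then
        memTable k n m q (i + 1) (m (2 + k + (n - 1 - q))) else 0) := by
    simp only [memTable, table, hi, if_true]
    rfl
  generalize hv : m (2 + k + (n - 1 - q)) = x at *
  -- up to the store, register `20` receives the new entry; the registers of the outer loops stay
  have main : Run (fun c => c.pc = 51 ∧ c.mem = μ ∧ c.reg 20 = memTable k n m (q + 1) i h ∧
      ∀ j < 19, c.reg j = r j) 12 ⟨37, r, μ⟩ := by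
    refine .jumpLt_pos rfl (by simp only; omega) ?_
    refine .step rfl (by simp only [Instr.Ok]; omega) ?_
    refine .step rfl (by simp [Instr.Ok, Instr.exec]; omega) ?_
    by_cases hs : m (2 + i) < m (2 + i + 1)
    · rw [if_pos hs] at new
      refine .jumpLt_pos rfl (by simp [Instr.exec]; omega) ?_
      refine .step rfl trivial ?_
      by_cases hx : x < memTable k n m q (i + 1) h
      · rw [if_pos hx] at new
        refine .jumpLt_pos rfl (by simp [Instr.exec, *]) ?_
        refine .step rfl trivial ?_
        refine .step rfl (by simp [Instr.Ok, Instr.exec, *]; omega) ?_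
        refine .done ⟨rfl, rfl, ?_, fun j hj => ?_⟩
        · simp [Instr.exec, *]; omega
        · simp (disch := omega) [Instr.exec, Function.update_of_ne]
      · rw [if_neg hx] at new
        refine .jumpLt_neg rfl (by simp [Instr.exec, *]) ?_
        refine .step rfl trivial ?_
        refine .done ⟨rfl, rfl, ?_, fun j hj => ?_⟩
        · simp [Instr.exec, *]
        · simp (disch := omega) [Instr.exec, Function.update_of_ne]
    · rw [if_neg hs] at new
      refine .jumpLt_neg rfl (by simp [Instr.exec]; omega) ?_
      refine .step rfl trivial ?_
      refine .step rfl trivial ?_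
      refine .step rfl trivial ?_
      by_cases hx : x < h
      · rw [if_pos hx] at new
        refine .jumpLt_pos rfl (by simp [Instr.exec, *]) ?_
        refine .step rfl trivial ?_
        refine .step rfl (by simp [Instr.Ok, Instr.exec, *]; omega) ?_
        refine .done ⟨rfl, rfl, ?_, fun j hj => ?_⟩
        · simp [Instr.exec, *]; omega
        · simp (disch := omega) [Instr.exec, Function.update_of_ne]
      · rw [if_neg hx] at new
        refine .jumpLt_neg rfl (by simp [Instr.exec, *]) ?_
        refine .step rfl trivial ?_
        refine .done ⟨rfl, rfl, ?_, fun j hj => ?_⟩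
        · simp [Instr.exec, *]
        · simp (disch := omega) [Instr.exec, Function.update_of_ne]
  refine (main.trans (M := 5) fun c hc => ?_).mono (by omega)
  obtain ⟨pc', r', μ'⟩ := c
  obtain ⟨hpc, hμ, h20, hr⟩ := hc
  simp only at hpc hμ h20 hr
  subst hpc hμ
  refine .step rfl (by simp [Instr.Ok, *]) ?_
  refine .step rfl (by simp [Instr.Ok, Instr.exec, *]; omega) ?_
  refine .step rfl (by simp [Instr.Ok, Instr.exec, *]; omega) ?_
  refine .step rfl (by simp [Instr.Ok, Instr.exec, *]; omega) ?_
  refine .step rfl trivial (.done ?_)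
  constructor
  case tab => exact tab.store hh (by simp [Instr.exec, *]) h20
  case toFrame =>
    constructor
    case input =>
      intro a ha
      have : a ≠ cell k n i h := by omega
      simp [Instr.exec, *]
    all_goals simp [Instr.exec, *]
  all_goals simp [Instr.exec, cell_add, *]

/-- Processing one row of the table. -/
theorem RowInv.next {q i : ℕ} {c : Config} (H : RowInv k n m q i c)
    (hw : k + n + 2 + (k + 1) * (n + 2) ≤ w) (hm : ∀ j < n, m (2 + k + j) ≤ n) (hq : q < n)
    (hi : i < k) : Run (RowInv k n m q (i + 1)) (8 + (n + 2) * 20 + 3) c := by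
  have start : Run (EntryInv k n m q i 0) 8 c := by
    obtain ⟨pc, r, μ⟩ := c
    obtain ⟨⟨r0, r1, r2, r3, r4, r5, r6, input⟩, hpc, r11, r12, r13, r8, r7, r14, tab⟩ := H
    simp only at *
    subst hpc
    have hv := hm (n - 1 - q) (by omega)
    have a1 := cell_lt (i := i + 1) (h := m (2 + k + (n - 1 - q))) hi (by omega : _ < n + 2)
    have a2 : cell k n i 0 + (n + 2) + m (2 + k + (n - 1 - q)) =
        cell k n (i + 1) (m (2 + k + (n - 1 - q))) := by unfold cell; ring
    have a3 := cell_row_succ k n i 0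
    have x1 := tab (i + 1) hi (m (2 + k + (n - 1 - q))) (by omega)
    rw [if_neg (by omega)] at x1
    simp only at x1
    have x2 := input (2 + i) (by omega)
    have x3 := input (2 + i + 1) (by omega)
    generalize hx : m (2 + k + (n - 1 - q)) = x at *
    refine .jumpLt_pos rfl (by simp only; omega) ?_
    refine .step rfl (by simp only [Instr.Ok]; omega) ?_
    refine .step rfl (by simp [Instr.Ok, Instr.exec]; omega) ?_
    refine .step rfl (by simp [Instr.Ok, Instr.exec]; omega) ?_
    refine .step rfl (by simp [Instr.Ok]) ?_
    refine .step rfl (by simp [Instr.Ok, Instr.exec]; omega) ?_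
    refine .step rfl (by simp [Instr.Ok, Instr.exec]; omega) ?_
    refine .step rfl (by simp [Instr.Ok, Instr.exec]; omega) ?_
    refine .done ?_
    constructor
    case tab => exact tab
    case toFrame =>
      constructor
      case input => exact input
      all_goals simp [Instr.exec, *]
    all_goals simp [Instr.exec, *]
  refine (start.trans fun c hc =>
    Reaches.loop _ (n + 2) 20 (fun h hh c hc => hc.next hw hi hh) hc).trans fun c H => ?_
  obtain ⟨pc, r, μ⟩ := c
  obtain ⟨⟨r0, r1, r2, r3, r4, r5, r6, input⟩, hpc, r11, r12, r13, r8, r7, r14, r15, r16, r9, r17,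
    r18, tab⟩ := H
  simp only at *
  subst hpc
  have a1 : cell k n i (n + 2) = cell k n (i + 1) 0 := by unfold cell; ring
  refine .jumpLt_neg rfl (by simp only; omega) ?_
  refine .step rfl (by simp only [Instr.Ok]; omega) ?_
  refine .step rfl trivial (.done ?_)
  constructor
  case tab =>
    intro i' hi' h' hh'
    refine (tab i' hi' h' hh').trans (if_congr ?_ rfl rfl)
    omega
  case toFrame =>
    constructor
    case input => exact input
    all_goals simp [Instr.exec, *]
  all_goals simp [Instr.exec, add_assoc, *]

/-- Processing one letter of the text. -/
theorem TextInv.next {q : ℕ} {c : Config} (H : TextInv k n m q c)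
    (hw : k + n + 2 + (k + 1) * (n + 2) ≤ w) (hm : ∀ j < n, m (2 + k + j) ≤ n) (hq : q < n) :
    Run (TextInv k n m (q + 1)) (6 + k * (8 + (n + 2) * 20 + 3) + 2) c := by
  have start : Run (RowInv k n m q 0) 6 c := by
    obtain ⟨pc, r, μ⟩ := c
    obtain ⟨⟨r0, r1, r2, r3, r4, r5, r6, input⟩, hpc, r11, r12, tab⟩ := H
    simp only at *
    subst hpc
    have e1 : k + n + 2 - q - 1 = k + n + 1 - q := by omega
    have e2 : k + n + 1 - q = 2 + k + (n - 1 - q) := by omega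
    have x1 := input (2 + k + (n - 1 - q)) (by omega)
    refine .jumpLt_pos rfl (by simp only; omega) ?_
    refine .step rfl trivial ?_
    refine .step rfl (by simp [Instr.Ok, Instr.exec]; omega) ?_
    refine .step rfl (by simp [Instr.Ok]) ?_
    refine .step rfl trivial ?_
    refine .step rfl (by simp [Instr.Ok]; omega) ?_
    refine .done ?_
    constructor
    case tab => exact tab
    case toFrame =>
      constructor
      case input => exact input
      all_goals simp [Instr.exec, *]
    all_goals simp [Instr.exec, cell_zero_zero, *]
  refine (start.trans fun c hc =>
    Reaches.loop _ k _ (fun i hi c hc => hc.next hw hm hq hi) hc).trans fun c H => ?_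
  obtain ⟨pc, r, μ⟩ := c
  obtain ⟨⟨r0, r1, r2, r3, r4, r5, r6, input⟩, hpc, r11, r12, r13, r8, r7, r14, tab⟩ := H
  simp only at *
  subst hpc
  refine .jumpLt_neg rfl (by simp only; omega) ?_
  refine .step rfl trivial (.done ?_)
  constructor
  case tab =>
    intro i' hi' h' hh'
    rw [if_neg (by omega)]
    refine (tab i' hi' h' hh').trans ?_
    split_ifs with hlt
    · rfl
    · obtain rfl : i' = k := by omega
      rw [memTable_last, memTable_last]
  case toFrame =>
    constructor
    case input => exact input
    all_goals simp [Instr.exec, *]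
  all_goals simp [Instr.exec, *]

/-- The invariant of the loop that finds the address of row `k`. -/
structure SeekInv (k n : ℕ) (m : ℕ → ℕ) (i : ℕ) (c : Config) : Prop extends Frame k n m c where
  pc : c.pc = 7
  r7 : c.reg 7 = cell k n i 0
  r8 : c.reg 8 = i
  r9 : c.reg 9 = 0
  tab : ∀ a, k + n + 2 ≤ a → c.mem a = 0

/-- The invariant of the loop that initializes row `k`. -/
structure FillInv (k n : ℕ) (m : ℕ → ℕ) (h : ℕ) (c : Config) : Prop extends Frame k n m c where
  pc : c.pc = 12
  r7 : c.reg 7 = cell k n k h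
  r9 : c.reg 9 = h
  tab : ∀ i' ≤ k, ∀ h' < n + 2, c.mem (cell k n i' h') = if i' = k ∧ h' < h then h' else 0

theorem SeekInv.next {i : ℕ} {c : Config} (H : SeekInv k n m i c)
    (hw : k + n + 2 + (k + 1) * (n + 2) ≤ w) (hi : i < k) : Run (SeekInv k n m (i + 1)) 4 c := by
  obtain ⟨pc, r, μ⟩ := c
  obtain ⟨⟨r0, r1, r2, r3, r4, r5, r6, input⟩, hpc, r7, r8, r9, tab⟩ := H
  simp only at *
  subst hpc
  have a1 := cell_lt (i := i + 1) (h := 0) hi (by omega : _ < n + 2)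
  have a2 := cell_row_succ k n i 0
  refine .jumpLt_pos rfl (by simp only; omega) ?_
  refine .step rfl (by simp only [Instr.Ok]; omega) ?_
  refine .step rfl (by simp [Instr.Ok, Instr.exec]; omega) ?_
  refine .step rfl trivial (.done ?_)
  constructor
  case tab => exact tab
  case toFrame =>
    constructor
    case input => exact input
    all_goals simp [Instr.exec, *]
  all_goals simp [Instr.exec, *]

theorem FillInv.next {h : ℕ} {c : Config} (H : FillInv k n m h c)
    (hw : k + n + 2 + (k + 1) * (n + 2) ≤ w) (hh : h < n + 2) :
    Run (FillInv k n m (h + 1)) 5 c := by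
  obtain ⟨pc, r, μ⟩ := c
  obtain ⟨⟨r0, r1, r2, r3, r4, r5, r6, input⟩, hpc, r7, r9, tab⟩ := H
  simp only at *
  subst hpc
  have a1 := cell_lt (k := k) le_rfl hh
  have a2 := le_cell k n k h
  refine .jumpLt_pos rfl (by simp only; omega) ?_
  refine .step rfl (by simp only [Instr.Ok]; omega) ?_
  refine .step rfl (by simp [Instr.Ok, Instr.exec]; omega) ?_
  refine .step rfl (by simp [Instr.Ok, Instr.exec]; omega) ?_
  refine .step rfl trivial (.done ?_)
  constructor
  case tab =>
    intro i' hi' h' hh'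
    simp only [Instr.exec, Function.update_apply, r7, r9, cell_inj hh' hh, tab i' hi' h' hh']
    split_ifs <;> omega
  case toFrame =>
    constructor
    case input =>
      intro a ha
      have : a ≠ cell k n k h := by omega
      simp [Instr.exec, *]
    all_goals simp [Instr.exec, *]
  all_goals simp [Instr.exec, cell_add, *]

/-- The initialization. -/
theorem reaches_textInv_zero (hw : k + n + 2 + (k + 1) * (n + 2) ≤ w) (h0 : m 0 = k) (h1 : m 1 = n)
    (hm : ∀ a, k + n + 2 ≤ a → m a = 0) :
    Run (TextInv k n m 0) (7 + k * 4 + 2 + (n + 2) * 5 + 5) ⟨0, fun _ => 0, m⟩ := by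
  have seek : Run (SeekInv k n m 0) 7 ⟨0, fun _ => 0, m⟩ := by
    refine .step rfl (by simp only [Instr.Ok]; omega) ?_
    refine .step rfl (by simp [Instr.Ok, Instr.exec]) ?_
    refine .step rfl (by simp [Instr.Ok, Instr.exec]; omega) ?_
    refine .step rfl (by simp [Instr.Ok, Instr.exec]; omega) ?_
    refine .step rfl (by simp [Instr.Ok, Instr.exec]; omega) ?_
    refine .step rfl (by simp [Instr.Ok, Instr.exec]; omega) ?_
    refine .step rfl trivial (.done ?_)
    constructor
    case tab => exact hm
    case toFrame => constructor <;> simp [Instr.exec, add_assoc, *]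
    all_goals simp [Instr.exec, cell_zero_zero, add_assoc, *]
  have fill : ∀ c, SeekInv k n m k c → Run (FillInv k n m 0) 2 c := by
    intro c H
    obtain ⟨pc, r, μ⟩ := c
    obtain ⟨⟨r0, r1, r2, r3, r4, r5, r6, input⟩, hpc, r7, r8, r9, tab⟩ := H
    simp only at *
    subst hpc
    refine .jumpLt_neg rfl (by simp only; omega) ?_
    refine .step rfl trivial (.done ?_)
    constructor
    case tab =>
      intro i' hi' h' hh'
      rw [if_neg (by omega)]
      exact tab _ (le_cell ..)
    case toFrame =>
      constructor
      case input => exact input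
      all_goals simp [Instr.exec, *]
    all_goals simp [Instr.exec, *]
  refine ((((seek.trans fun c hc => Reaches.loop _ k 4 (fun i hi c hc => hc.next hw hi) hc).trans
    fill).trans fun c hc =>
      Reaches.loop _ (n + 2) 5 (fun h hh c hc => hc.next hw hh) hc)).trans fun c H => ?_
  obtain ⟨pc, r, μ⟩ := c
  obtain ⟨⟨r0, r1, r2, r3, r4, r5, r6, input⟩, hpc, r7, r9, tab⟩ := H
  simp only at *
  subst hpc
  refine .jumpLt_neg rfl (by simp only; omega) ?_
  refine .step rfl trivial ?_
  refine .step rfl trivial ?_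
  refine .step rfl (by simp [Instr.Ok, Instr.exec]; omega) ?_
  refine .step rfl (by simp [Instr.Ok, Instr.exec]; omega) (.done ?_)
  constructor
  case tab =>
    intro i' hi' h' hh'
    rw [if_neg (by omega)]
    refine (tab i' hi' h' hh').trans ?_
    simp only [memTable, table]
    split_ifs <;> omega
  case toFrame =>
    constructor
    case input => exact input
    all_goals simp [Instr.exec, *]
  all_goals simp [Instr.exec, *]

/-- The program answers whether the last entry of row `0` of the final table is positive. -/
theorem matcher_reaches_halt (hw : k + n + 2 + (k + 1) * (n + 2) ≤ w) (h0 : m 0 = k) (h1 : m 1 = n)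
    (hm : ∀ j < n, m (2 + k + j) ≤ n) (hm' : ∀ a, k + n + 2 ≤ a → m a = 0) :
    Run (fun c => matcher[c.pc]? = some (.halt (decide (0 < memTable k n m n 0 (n + 1)))))
      (7 + k * 4 + 2 + (n + 2) * 5 + 5 + n * (6 + k * (8 + (n + 2) * 20 + 3) + 2) + 5)
      ⟨0, fun _ => 0, m⟩ := by
  refine ((reaches_textInv_zero hw h0 h1 hm').trans fun c hc =>
    Reaches.loop _ n _ (fun q hq c hc => hc.next hw hm hq) hc).trans fun c H => ?_
  obtain ⟨pc, r, μ⟩ := c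
  obtain ⟨⟨r0, r1, r2, r3, r4, r5, r6, input⟩, hpc, r11, r12, tab⟩ := H
  simp only at *
  subst hpc
  have a1 := cell_lt (k := k) (i := 0) (Nat.zero_le _) (Nat.lt_succ_self (n + 1))
  have a2 : k + n + 2 + (n + 1) = cell k n 0 (n + 1) := by unfold cell; ring
  have x1 := tab 0 (Nat.zero_le _) (n + 1) (by omega)
  rw [if_neg (by omega)] at x1
  simp only at x1
  refine .jumpLt_neg rfl (by simp only; omega) ?_
  refine .step rfl trivial ?_
  refine .step rfl (by simp [Instr.Ok, Instr.exec]; omega) ?_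
  refine .step rfl (by simp [Instr.Ok, Instr.exec]; omega) ?_
  by_cases hx : 0 < memTable k n m n 0 (n + 1)
  · refine .jumpLt_pos rfl (by simp [Instr.exec, *]) (.done ?_)
    simp [matcher, hx]
  · refine .jumpLt_neg rfl (by simp [Instr.exec, *]) (.done ?_)
    simp [matcher, Instr.exec, hx]

end Verification

end RAM

/-! ### The input -/

section Input

variable {k n : ℕ} (σ : Equiv.Perm (Fin k)) (π : Equiv.Perm (Fin n))

theorem matchingInput_pattern (i : Fin k) :
    (matchingInput σ π).getD (2 + i) 0 = σ i + 1 := by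
  have : 2 + (i : ℕ) = i + 1 + 1 := by omega
  simp [matchingInput, this, List.getElem?_append_left]

theorem matchingInput_text (j : Fin n) :
    (matchingInput σ π).getD (2 + k + j) 0 = π j + 1 := by
  have : 2 + k + (j : ℕ) = k + j + 1 + 1 := by omega
  simp [matchingInput, this]

theorem matchingInput_of_le {a : ℕ} (ha : k + n + 2 ≤ a) :
    (matchingInput σ π).getD a 0 = 0 := by
  apply List.getD_eq_default
  simp [matchingInput]
  omega

theorem matchingInput_le (a : ℕ) : (matchingInput σ π).getD a 0 ≤ k + n := by
  match a with
  | 0 => simp [matchingInput]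
  | 1 => simp [matchingInput]
  | a + 2 =>
    by_cases h1 : a < k
    · have := matchingInput_pattern σ π ⟨a, h1⟩
      have h2 := (σ ⟨a, h1⟩).isLt
      simp only [add_comm 2] at this
      omega
    · by_cases h2 : a < k + n
      · have := matchingInput_text σ π ⟨a - k, by omega⟩
        have h3 := (π ⟨a - k, by omega⟩).isLt
        have h4 : 2 + k + (a - k) = a + 2 := by omega
        simp only [h4] at this
        omega
      · rw [matchingInput_of_le σ π (by omega)]
        exact Nat.zero_le _

end Input

theorem mainTheorem1 :
    ∃ (P : RAM.Program) (C : ℕ), ∀ (k n : ℕ) (σ : Equiv.Perm (Fin k)) (π : Equiv.Perm (Fin n)),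
      σ ∈ Av k {⟨3, perm213⟩, ⟨3, perm231⟩} →
        ∃ (T : ℕ) (answer : Bool),
          P.HaltsWithin (matchingInput σ π) T answer ∧
          (answer = true ↔ Matches π σ) ∧
          P.WordsWithin (matchingInput σ π) ((k + n + 2) ^ C) ∧
          (1 ≤ k → 1 ≤ n →
            (T : ℝ) ≤ C * max ((k : ℝ) * (n : ℝ) ^ 2)
              ((n : ℝ) ^ 2 * Real.log (Real.log (n : ℝ))) ∧
            P.SpaceWithin (matchingInput σ π) (C * (k * n ^ 2))) := by
  -- `200` exceeds the sum of the coefficients of the step count expanded at the end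
  refine ⟨RAM.matcher, 200, fun k n σ π hσ => ?_⟩
  set m : ℕ → ℕ := fun a => (matchingInput σ π).getD a 0 with hm
  -- all cells that are used, and hence all addresses, lie within the word bound
  have hw : k + n + 2 + (k + 1) * (n + 2) ≤ (k + n + 2) ^ 200 := by
    calc k + n + 2 + (k + 1) * (n + 2) ≤ (k + n + 2) ^ 3 := by
          have h1 : (k + 1) * (n + 2) ≤ (k + n + 2) * (k + n + 2) := by gcongr <;> omega
          have h2 : 2 * ((k + n + 2) * (k + n + 2)) ≤
            (k + n + 2) * ((k + n + 2) * (k + n + 2)) := by gcongr; omega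
          have h3 : k + n + 2 ≤ (k + n + 2) * (k + n + 2) := Nat.le_mul_self _
          calc _ ≤ (k + n + 2) * ((k + n + 2) * (k + n + 2)) := by omega
            _ = _ := by ring
      _ ≤ _ := Nat.pow_le_pow_right (by omega) (by norm_num)
  have htext : ∀ j < n, m (2 + k + j) ≤ n := fun j hj => by
    have := matchingInput_text σ π ⟨j, hj⟩
    have h2 := (π ⟨j, hj⟩).isLt
    simp only [hm]
    simp only at this
    omega
  -- the power is hidden, lest it be unfolded in the unifications below
  generalize (k + n + 2) ^ 200 = w at hw ⊢
  obtain ⟨halts, words, space⟩ := (RAM.matcher_reaches_halt (m := m) hw rfl rfl htext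
    (fun a ha => matchingInput_of_le σ π ha)).spec fun i =>
      ⟨Nat.zero_le _, (matchingInput_le σ π i).trans (by omega)⟩
  refine ⟨_, _, halts, ?_, words, fun hk hn => ?_⟩
  · rw [decide_eq_true_iff]
    exact (matches_iff_table_pos hσ (matchingInput_pattern σ π) (matchingInput_text σ π)).symm
  have h1 : n ≤ k * n ^ 2 := (Nat.le_self_pow two_ne_zero n).trans (Nat.le_mul_of_pos_left _ hk)
  have h2 : k ≤ k * n ^ 2 := Nat.le_mul_of_pos_right _ (by positivity)
  have h3 : k * n ≤ k * n ^ 2 := Nat.mul_le_mul_left _ (Nat.le_self_pow two_ne_zero n)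
  refine ⟨?_, fun t I a hI ha => ?_⟩
  · refine le_trans ?_ (mul_le_mul_of_nonneg_left (le_max_left _ _) (Nat.cast_nonneg _))
    norm_cast
    calc 7 + k * 4 + 2 + (n + 2) * 5 + 5 + n * (6 + k * (8 + (n + 2) * 20 + 3) + 2) + 5
        = 29 + 4 * k + 13 * n + 51 * (k * n) + 20 * (k * n ^ 2) := by ring
      _ ≤ 200 * (k * n ^ 2) := by omega
  · refine (space t I a hI ha).trans_le ?_
    calc k + n + 2 + (k + 1) * (n + 2) = 4 + 3 * k + 2 * n + k * n := by ring
      _ ≤ 200 * (k * n ^ 2) := by omega
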